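/- There is an absolute constant $C$ such that the following holds. Let $F$ (firms) and $W$ (workers) be disjoint finite sets. Let a set of acceptable pairs in $F\times W$ be given, and write $W(f)=\{w : (f,w) \text{ acceptable}\}$ and $F(w)=\{f : (f,w)\text{ acceptable}\}$. Let every firm $f$ have a choice function $\mathcal C_f:2^{W(f)}\to 2^{W(f)}$ and every worker $w$ a choice function $\mathcal C_w:2^{F(w)}\to 2^{F(w)}$, with $\mathcal C_a(S)\subseteq S$ for every agent $a$ and every set $S$ of partners acceptable to $a$. Suppose that for every agent $a\in F\cup W$ (all sets below being sets of acceptable partners of $a$) the function $\mathcal C_a$ is - substitutable: if $b\in\mathcal C_a(S)$ and $T\subseteq S$, then $b\in \mathcal C_a(T\cup\{b\})$; - consistent: if $\mathcal C_a(S)\subseteq T\subseteq S$, then $\mathcal C_a(S)=\mathcal C_a(T)$; - cardinal monotone: if $S\subseteq T$, then $|\mathcal C_a(S)|\le|\mathcal C_a(T)|$. A matching is a set $\mu$ of acceptable pairs; put $\mu(f)=\{w:(f,w)\in\mu\}$ and $\mu(w)=\{f:(f,w)\in\mu\}$. It is stable if $\mathcal C_a(\mu(a))=\mu(a)$ for every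 agent $a$ and there is no acceptable pair $(f,w)\notin\mu$ with $w\in\mathcal C_f(\mu(f)\cup\{w\})$ and $f\in\mathcal C_w(\mu(w)\cup\{f\})$. Let $\mathcal S$ be the set of stable matchings and let $\operatorname{conv}(\mathcal S)\subseteq\mathbb R^{F\times W}$ be the convex hull of the characteristic vectors $\chi^\mu$, $\mu\in\mathcal S$. Then $\operatorname{conv}(\mathcal S)$ has at most $C\,|F|^2|W|^2$ facets, where a facet of a polytope $P$ is a nonempty face of $P$ of dimension $\dim P-1$. -/

import Mathlib

namespace StableMatching

/-! ### Properties of choice functions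

A choice function of an agent with set of acceptable partners `A` is a map `C` on the subsets of
`A`. It is encoded as a map on all finsets, of which only the values at subsets of `A` are ever
used or restricted. -/

/-- `C` selects, from every set of acceptable partners, a subset of that set. -/
def IsChoice {α : Type*} (A : Finset α) (C : Finset α → Finset α) : Prop :=
  ∀ S ⊆ A, C S ⊆ S

/-- Substitutability. -/
def Substitutable {α : Type*} [DecidableEq α] (A : Finset α) (C : Finset α → Finset α) : Prop :=
  ∀ S ⊆ A, ∀ b ∈ C S, ∀ T ⊆ S, b ∈ C (T ∪ {b})

/-- Consistency. -/
def Consistent {α : Type*} (A : Finset α) (C : Finset α → Finset α) : Prop :=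
  ∀ S ⊆ A, ∀ T, C S ⊆ T → T ⊆ S → C S = C T

/-- Cardinal monotonicity. -/
def CardinalMonotone {α : Type*} (A : Finset α) (C : Finset α → Finset α) : Prop :=
  ∀ T ⊆ A, ∀ S ⊆ T, (C S).card ≤ (C T).card

/-! ### Matching markets -/

section Market

variable {F W : Type*} [Fintype F] [Fintype W] [DecidableEq F] [DecidableEq W]

/-- The workers paired with the firm `f` in a set of firm-worker pairs. -/
def workersOf (μ : Finset (F × W)) (f : F) : Finset W :=
  Finset.univ.filter fun w => (f, w) ∈ μ

/-- The firms paired with the worker `w` in a set of firm-worker pairs. -/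
def firmsOf (μ : Finset (F × W)) (w : W) : Finset F :=
  Finset.univ.filter fun f => (f, w) ∈ μ

variable (F W) in
/-- A matching market with firms `F` and workers `W`: the acceptable pairs (so that
`W(f) = workersOf acceptable f` and `F(w) = firmsOf acceptable w`), and a choice function for each
firm and each worker. -/
structure MatchingMarket where
  acceptable : Finset (F × W)
  choiceF : F → Finset W → Finset W
  choiceW : W → Finset F → Finset F
  isChoice_choiceF : ∀ f, IsChoice (workersOf acceptable f) (choiceF f)
  isChoice_choiceW : ∀ w, IsChoice (firmsOf acceptable w) (choiceW w)

namespace MatchingMarket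

variable (M : MatchingMarket F W)

/-- The model in which the choice functions of all agents are substitutable, consistent and
cardinal monotone. -/
def IsCMModel : Prop :=
  (∀ f, Substitutable (workersOf M.acceptable f) (M.choiceF f) ∧
    Consistent (workersOf M.acceptable f) (M.choiceF f) ∧
    CardinalMonotone (workersOf M.acceptable f) (M.choiceF f)) ∧
  (∀ w, Substitutable (firmsOf M.acceptable w) (M.choiceW w) ∧
    Consistent (firmsOf M.acceptable w) (M.choiceW w) ∧
    CardinalMonotone (firmsOf M.acceptable w) (M.choiceW w))

/-- A matching, viewed as a collection of firm-worker pairs: all its pairs are acceptable. -/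
def IsMatching (μ : Finset (F × W)) : Prop :=
  μ ⊆ M.acceptable

/-- Individual rationality. -/
def IndividuallyRational (μ : Finset (F × W)) : Prop :=
  (∀ f, M.choiceF f (workersOf μ f) = workersOf μ f) ∧
  (∀ w, M.choiceW w (firmsOf μ w) = firmsOf μ w)

/-- The acceptable pair `(f, w)` lies outside `μ` and blocks it. -/
def IsBlockingPair (μ : Finset (F × W)) (f : F) (w : W) : Prop :=
  (f, w) ∈ M.acceptable ∧ (f, w) ∉ μ ∧
    w ∈ M.choiceF f (workersOf μ f ∪ {w}) ∧ f ∈ M.choiceW w (firmsOf μ w ∪ {f})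

/-- Stability. -/
def IsStable (μ : Finset (F × W)) : Prop :=
  M.IsMatching μ ∧ M.IndividuallyRational μ ∧ ∀ f w, ¬ M.IsBlockingPair μ f w

end MatchingMarket

/-- The characteristic vector, in `ℝ^(F × W)`, of a set of firm-worker pairs. -/
def charVec (μ : Finset (F × W)) : F × W → ℝ :=
  fun p => if p ∈ μ then 1 else 0

/-- The stable matching polytope: the convex hull of the characteristic vectors of the stable
matchings. -/
def MatchingMarket.stablePolytope (M : MatchingMarket F W) : Set (F × W → ℝ) :=
  convexHull ℝ {x | ∃ μ, M.IsStable μ ∧ x = charVec μ}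

end Market

/-! ### Facets -/

/-- The dimension of the affine hull of a set. -/
noncomputable def affDim {E : Type*} [AddCommGroup E] [Module ℝ E] (P : Set E) : ℕ :=
  Module.finrank ℝ (vectorSpan ℝ P)

/-- A facet of a polytope `P`: a nonempty face of `P` (the set of maximizers over `P` of a linear
functional) whose dimension is one less than that of `P`. -/
def IsFacet {E : Type*} [AddCommGroup E] [Module ℝ E] (P G : Set E) : Prop :=
  G.Nonempty ∧ (∃ l : E →ₗ[ℝ] ℝ, G = {x ∈ P | ∀ y ∈ P, l y ≤ l x}) ∧ affDim G + 1 = affDim P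

/-- The set of facets of `P`. -/
def facets {E : Type*} [AddCommGroup E] [Module ℝ E] (P : Set E) : Set (Set E) :=
  {G | IsFacet P G}

end StableMatching

namespace StableMatching

/-! ### Finite lattices -/

section FiniteLattice

variable {L : Type*} [Lattice L] [Finite L]

/-! Put `E = F × W`. Merging all firms into one choice function on sets of pairs, and all workers
into another, keeps substitutability, consistency and cardinal monotonicity, so a market is a pair
of choice functions on `E`.

Stable sets form a lattice under the firms' preference (`exists_join`). They all have the same size,
which forces `χ(a ⊔ b) + χ(a ⊓ b) = χ(a) + χ(b)` (`isModularFamily_stable`). Consequently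
join-irreducibles are prime, there are at most `|E|` of them, and each indicator `[j ≤ a]` is a
linear functional `φ j` of `χ(a)` (`exists_functional`). The polytope thus behaves like the order
polytope of the poset of irreducibles.

A linear functional is modular on this lattice. If its maximizers satisfy none of `φ j = 0`, `φ j =
1`, `φ i = φ j` (`i < j`) identically, it is constant (`modular_eq_of_maximizers`). So each facet is
cut out by one of these equations, which leaves at most `|E|² + 2|E|` facets. -/

theorem exists_isLeast_of_inf_closed (s : Set L) (hne : s.Nonempty)
    (h : ∀ a ∈ s, ∀ b ∈ s, a ⊓ b ∈ s) : ∃ m, IsLeast s m := by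
  obtain ⟨m, hm⟩ := s.toFinite.exists_minimal hne
  exact ⟨m, hm.prop, fun a ha =>
    (hm.le_of_le (h m hm.prop a ha) inf_le_left).trans inf_le_right⟩

theorem exists_isGreatest_of_sup_closed (s : Set L) (hne : s.Nonempty)
    (h : ∀ a ∈ s, ∀ b ∈ s, a ⊔ b ∈ s) : ∃ m, IsGreatest s m :=
  exists_isLeast_of_inf_closed (L := Lᵒᵈ) s hne h

/-- Take `j` minimal among the elements below `a` but not below `b`: everything strictly below `j`
lies below `b`, and so does the join of two such elements. -/
theorem exists_supIrred_le_not_le {a b : L} (h : ¬ a ≤ b) : ∃ j, SupIrred j ∧ j ≤ a ∧ ¬ j ≤ b := by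
  obtain ⟨j, hj⟩ := ({c | c ≤ a ∧ ¬ c ≤ b} : Set L).toFinite.exists_minimal ⟨a, le_rfl, h⟩
  refine ⟨j, ⟨fun hmin => hj.prop.2 ((hmin inf_le_left).trans inf_le_right), ?_⟩, hj.prop⟩
  intro c d hcd
  by_contra! hne
  have below : ∀ e ≤ j, e ≠ j → e ≤ b := fun e he hej => by
    by_contra heb
    exact hej (le_antisymm he (hj.le_of_le ⟨he.trans hj.prop.1, heb⟩ he))
  exact hj.prop.2 (hcd ▸ sup_le (below c (hcd ▸ le_sup_left) hne.1)
    (below d (hcd ▸ le_sup_right) hne.2))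

theorem SupIrred.exists_isGreatest_Iio {j : L} (hj : SupIrred j) :
    ∃ i, IsGreatest (Set.Iio j) i := by
  refine exists_isGreatest_of_sup_closed _ (not_isMin_iff.1 hj.1) fun a ha b hb => ?_
  refine lt_of_le_of_ne (sup_le ha.le hb.le) fun h => ?_
  rcases hj.2 h with h | h
  · exact ha.ne h
  · exact hb.ne h

variable (hprime : ∀ j : L, SupIrred j → ∀ a b, j ≤ a ⊔ b → j ≤ a ∨ j ≤ b)
  {l : L → ℝ} (hl : ∀ a b, l (a ⊔ b) + l (a ⊓ b) = l a + l b)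

include hprime hl in
/-- Removing a maximal irreducible `j` from below `a` changes a modular function by its increment
at `j`. -/
theorem exists_lt_sub_eq {j i a : L} (hj : SupIrred j) (hi : IsGreatest (Set.Iio j) i) (hja : j ≤ a)
    (hmax : ∀ k, SupIrred k → k ≤ a → j ≤ k → k = j) :
    ∃ a' < a, l a - l a' = l j - l i := by
  -- `a'` is the largest element below `a` and not above `j`; it exists because `j` is prime. Then
  -- `a' ⊔ j = a` and `a' ⊓ j = i`, and modularity gives the claim.
  obtain ⟨a', ha', hup⟩ := exists_isGreatest_of_sup_closed {b | b ≤ a ∧ ¬ j ≤ b}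
    ⟨i, hi.1.le.trans hja, not_le_of_gt hi.1⟩ fun b hb c hc =>
      ⟨sup_le hb.1 hc.1, fun h => (hprime j hj b c h).elim hb.2 hc.2⟩
  have hsup : a' ⊔ j = a := by
    refine le_antisymm (sup_le ha'.1 hja) ?_
    by_contra h
    obtain ⟨k, hk, hka, hkn⟩ := exists_supIrred_le_not_le h
    by_cases hjk : j ≤ k
    · exact hkn (hmax k hk hka hjk ▸ le_sup_right)
    · exact hkn ((hup ⟨hka, hjk⟩).trans le_sup_left)
  have hinf : a' ⊓ j = i := by
    refine le_antisymm (hi.2 (lt_of_le_of_ne inf_le_right fun h => ha'.2 (inf_eq_right.1 h))) ?_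
    exact le_inf (hup ⟨hi.1.le.trans hja, not_le_of_gt hi.1⟩) hi.1.le
  refine ⟨a', lt_of_le_of_ne ha'.1 fun h => ha'.2 (h ▸ hja), ?_⟩
  have := hl a' j
  rw [hsup, hinf] at this
  linarith

include hprime hl in
/-- A modular function whose maximizers satisfy none of the order relations with equality is
constant. -/
theorem modular_eq_of_maximizers
    (h₁ : ∀ j, SupIrred j → ∃ a, (∀ b, l b ≤ l a) ∧ j ≤ a)
    (h₀ : ∀ j, SupIrred j → ∃ a, (∀ b, l b ≤ l a) ∧ ¬ j ≤ a)
    (h₂ : ∀ i j, SupIrred i → SupIrred j → i < j → ∃ a, (∀ b, l b ≤ l a) ∧ i ≤ a ∧ ¬ j ≤ a)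
    (a b : L) : l a = l b := by
  have hsup : ∀ a b, (∀ c, l c ≤ l a) → (∀ c, l c ≤ l b) → ∀ c, l c ≤ l (a ⊔ b) := by
    intro a b ha hb c
    linarith [hl a b, hb (a ⊓ b), ha c]
  have hinf : ∀ a b, (∀ c, l c ≤ l a) → (∀ c, l c ≤ l b) → ∀ c, l c ≤ l (a ⊓ b) := by
    intro a b ha hb c
    linarith [hl a b, hb (a ⊔ b), ha c]
  have incr : ∀ j i, SupIrred j → IsGreatest (Set.Iio j) i → l j = l i := by
    intro j i hj hi
    apply le_antisymm
    -- Let `v` be the largest maximizer not above `j`. By `h₂` every irreducible below `i` is below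
    -- `v`, so `v ⊓ j = i`, and joining `j` to `v` cannot increase `l`.
    · obtain ⟨v, hv, hup⟩ := exists_isGreatest_of_sup_closed {a | (∀ b, l b ≤ l a) ∧ ¬ j ≤ a}
        (h₀ j hj) fun b hb c hc =>
          ⟨hsup b c hb.1 hc.1, fun h => (hprime j hj b c h).elim hb.2 hc.2⟩
      have hvj : v ⊓ j = i := by
        refine le_antisymm (hi.2 (lt_of_le_of_ne inf_le_right fun h => hv.2 (inf_eq_right.1 h)))
          (le_inf ?_ hi.1.le)
        by_contra h
        obtain ⟨k, hk, hki, hkv⟩ := exists_supIrred_le_not_le h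
        obtain ⟨u, hu, hku, hju⟩ := h₂ k j hk hj (lt_of_le_of_lt hki hi.1)
        exact hkv (hku.trans (hup ⟨hu, hju⟩))
      have := hl v j
      rw [hvj] at this
      linarith [hv.1 (v ⊔ j)]
    -- Let `v` be the least maximizer above `j`. By `h₂` no irreducible below `v` exceeds `j`, so
    -- `j` can be removed from `v`, which cannot increase `l`.
    · obtain ⟨v, hv, hlow⟩ := exists_isLeast_of_inf_closed {a | (∀ b, l b ≤ l a) ∧ j ≤ a}
        (h₁ j hj) fun b hb c hc => ⟨hinf b c hb.1 hc.1, le_inf hb.2 hc.2⟩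
      obtain ⟨v', -, hv'⟩ := exists_lt_sub_eq hprime hl hj hi hv.2 fun k hk hkv hjk => by
        by_contra hne
        obtain ⟨u, hu, hju, hku⟩ := h₂ j k hj hk (lt_of_le_of_ne hjk (Ne.symm hne))
        exact hku (hkv.trans (hlow ⟨hu, hju⟩))
      linarith [hv.1 v']
  obtain ⟨z, -, hz⟩ := exists_isLeast_of_inf_closed (Set.univ : Set L) ⟨a, trivial⟩
    fun _ _ _ _ => trivial
  have eq_bot : ∀ a, l a = l z := by
    intro a
    induction a using WellFoundedLT.induction with
    | ind a ih =>
      by_cases haz : a ≤ z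
      · rw [le_antisymm haz (hz trivial)]
      obtain ⟨k, hk, hka, -⟩ := exists_supIrred_le_not_le haz
      obtain ⟨j, hj⟩ := ({k | SupIrred k ∧ k ≤ a} : Set L).toFinite.exists_maximal ⟨k, hk, hka⟩
      obtain ⟨i, hi⟩ := SupIrred.exists_isGreatest_Iio hj.prop.1
      obtain ⟨a', ha', h⟩ := exists_lt_sub_eq hprime hl hj.prop.1 hi hj.prop.2
        fun k hk hka hjk => le_antisymm (hj.le_of_ge ⟨hk, hka⟩ hjk) hjk
      linarith [ih a' ha', incr j i hj.prop.1 hi]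
  rw [eq_bot a, eq_bot b]

end FiniteLattice

/-! ### Lattices of sets whose characteristic vectors form a modular family -/

/-- A lattice `L` represented by sets `x a`, such that joins and meets preserve the sum of
characteristic vectors, and membership of an element is a convex property. -/
structure IsModularFamily {L E : Type*} [Lattice L] [DecidableEq E] (x : L → Finset E) : Prop where
  union_eq : ∀ a b, x (a ⊔ b) ∪ x (a ⊓ b) = x a ∪ x b
  inter_eq : ∀ a b, x (a ⊔ b) ∩ x (a ⊓ b) = x a ∩ x b
  convex : ∀ a b c e, a ≤ b → b ≤ c → e ∈ x a → e ∈ x c → e ∈ x b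
  eq_of_subset : ∀ a b, a ≤ b → x b ⊆ x a → a = b

namespace IsModularFamily

variable {L E : Type*} [Lattice L] [DecidableEq E] {x : L → Finset E}
  (hx : IsModularFamily x)

/-- The characteristic vector of a finite set. -/
def indicatorVec (s : Finset E) : E → ℝ := fun e => if e ∈ s then 1 else 0

include hx

theorem mem_or (a b : L) (e : E) : (e ∈ x (a ⊔ b) ∨ e ∈ x (a ⊓ b)) ↔ (e ∈ x a ∨ e ∈ x b) := by
  rw [← Finset.mem_union, hx.union_eq, Finset.mem_union]

theorem mem_and (a b : L) (e : E) : (e ∈ x (a ⊔ b) ∧ e ∈ x (a ⊓ b)) ↔ (e ∈ x a ∧ e ∈ x b) := by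
  rw [← Finset.mem_inter, hx.inter_eq, Finset.mem_inter]

theorem indicatorVec_add (a b : L) :
    indicatorVec (x (a ⊔ b)) + indicatorVec (x (a ⊓ b)) =
      indicatorVec (x a) + indicatorVec (x b) := by
  ext e
  have h₁ := hx.mem_or a b e
  have h₂ := hx.mem_and a b e
  simp only [indicatorVec, Pi.add_apply]
  by_cases h3 : e ∈ x a <;> by_cases h4 : e ∈ x b <;> by_cases h5 : e ∈ x (a ⊔ b) <;>
    by_cases h6 : e ∈ x (a ⊓ b) <;> simp_all

/-- Choose `e` in `x j` but not in `x i`, where `i` is the lower cover of `j`. If `e ∈ x a` without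
`j ≤ a`, then `e ∈ x (a ⊓ j)` with `a ⊓ j ≤ i < j`, and convexity would put `e` in `x i`. -/
theorem exists_mem_forall_le [Finite L] {j : L} (hj : SupIrred j) :
    ∃ e ∈ x j, ∀ a, e ∈ x a → j ≤ a := by
  obtain ⟨i, hij, hi⟩ := SupIrred.exists_isGreatest_Iio hj
  have : ¬ x j ⊆ x i := fun h => (ne_of_lt hij) (hx.eq_of_subset i j hij.le h)
  obtain ⟨e, he, hei⟩ := Finset.not_subset.1 this
  refine ⟨e, he, fun a ha => ?_⟩
  by_contra hja
  have hmem := ((hx.mem_and a j e).2 ⟨ha, he⟩).2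
  exact hei (hx.convex _ i j e
    (hi (lt_of_le_of_ne inf_le_right fun h => hja (inf_eq_right.1 h))) hij.le hmem he)

/-- Let `e` be the element marking `j`. If `j` is below neither `a` nor `b`, then `e` lies in both
`x (j ⊔ a)` and `x (j ⊔ b)`, hence in the set of their join `a ⊔ b`, hence in `x a` or `x b`: a
contradiction. -/
theorem le_or_le_of_le_sup [Finite L] (j : L) (hj : SupIrred j) (a b : L) (h : j ≤ a ⊔ b) :
    j ≤ a ∨ j ≤ b := by
  obtain ⟨e, he, hle⟩ := hx.exists_mem_forall_le hj
  by_contra! hn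
  have key : ∀ c, ¬ j ≤ c → e ∈ x (j ⊔ c) := fun c hc =>
    ((hx.mem_or j c e).2 (.inl he)).resolve_right fun h => hc ((hle _ h).trans inf_le_right)
  have hab := ((hx.mem_and (j ⊔ a) (j ⊔ b) e).2 ⟨key a hn.1, key b hn.2⟩).1
  rw [← sup_sup_distrib_left, sup_eq_right.2 h] at hab
  rcases (hx.mem_or a b e).1 (.inl hab) with h | h
  · exact hn.1 (hle _ h)
  · exact hn.2 (hle _ h)

open scoped Classical in
-- The coordinate at the element `e` marking `j` equals `[j ≤ a]`, unless `e` disappears higher up.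
-- By convexity it then disappears exactly above a least element `n`, itself irreducible, so `[j ≤
-- a]` is that coordinate plus `[n ≤ a]`; induct downwards from the top.
theorem exists_functional [Finite L] (j : L) (hj : SupIrred j) :
    ∃ φ : (E → ℝ) →ₗ[ℝ] ℝ, ∀ a, φ (indicatorVec (x a)) = if j ≤ a then 1 else 0 := by
  induction j using WellFoundedGT.induction with
  | ind j ih =>
    obtain ⟨e, he, hle⟩ := hx.exists_mem_forall_le hj
    by_cases hall : ∀ a, j ≤ a → e ∈ x a
    · refine ⟨LinearMap.proj e, fun a => ?_⟩
      have : e ∈ x a ↔ j ≤ a := ⟨hle a, hall a⟩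
      simp [indicatorVec, this]
    push Not at hall
    obtain ⟨n, hn, hlow⟩ := exists_isLeast_of_inf_closed {a | j ≤ a ∧ e ∉ x a} hall
      fun a ha b hb => ⟨le_inf ha.1 hb.1, fun h =>
        ((hx.mem_or a b e).1 (.inr h)).elim ha.2 hb.2⟩
    have hjn : j < n := lt_of_le_of_ne hn.1 fun h => hn.2 (h ▸ he)
    -- If `n = c ⊔ d` properly, leastness of `n` and primality of `j` put `e` in `x c ∪ x d`. Since
    -- `e ∉ x n`, it lies in `x (c ⊓ d)`, so `j` is below both `c` and `d`, and then `e ∈ x c ∩ x d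
    -- ⊆ x n`.
    have hirr : SupIrred n := by
      refine ⟨fun h => h.not_lt hjn, fun c d hcd => ?_⟩
      by_contra! hne
      have hc : j ≤ c → e ∈ x c := fun h => by
        by_contra h'
        exact hne.1 (le_antisymm (hcd ▸ le_sup_left) (hlow ⟨h, h'⟩))
      have hd : j ≤ d → e ∈ x d := fun h => by
        by_contra h'
        exact hne.2 (le_antisymm (hcd ▸ le_sup_right) (hlow ⟨h, h'⟩))
      have hmem : e ∈ x c ∨ e ∈ x d :=
        (hx.le_or_le_of_le_sup j hj c d (hcd ▸ hn.1)).imp hc hd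
      rcases (hx.mem_or c d e).2 hmem with h | h
      · exact hn.2 (hcd ▸ h)
      · have hle' := hle _ h
        exact hn.2 (hcd ▸ ((hx.mem_and c d e).2
          ⟨hc (hle'.trans inf_le_left), hd (hle'.trans inf_le_right)⟩).1)
    obtain ⟨φ, hφ⟩ := ih n hjn hirr
    refine ⟨LinearMap.proj e + φ, fun a => ?_⟩
    rw [LinearMap.add_apply, hφ]
    by_cases hna : n ≤ a
    · have : e ∉ x a := fun h => hn.2 (hx.convex j n a e hjn.le hna he h)
      simp [indicatorVec, this, hna, hn.1.trans hna]
    · have : e ∈ x a ↔ j ≤ a := ⟨hle a, fun h => by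
        by_contra h'
        exact hna (hlow ⟨h, h'⟩)⟩
      simp [indicatorVec, this, hna]

theorem card_supIrred_le [Finite L] [Fintype E] :
    Nat.card {j : L // SupIrred j} ≤ Fintype.card E := by
  choose e he hle using fun j : {j : L // SupIrred j} => hx.exists_mem_forall_le j.2
  rw [← Nat.card_eq_fintype_card]
  refine Nat.card_le_card_of_injective e fun i j hij => Subtype.ext (le_antisymm ?_ ?_)
  · exact hle i _ (hij ▸ he j)
  · exact hle j _ (hij ▸ he i)

end IsModularFamily

/-! ### Facets -/

/-- The direction space of `G` lies in that of `P` cut by `ker φ`, a proper subspace; codimension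
one forces equality. The functional defining `G` vanishes on these directions, so every point of `P`
on the hyperplane is also a maximizer. -/
theorem IsFacet.eq_inter_hyperplane {V : Type*} [AddCommGroup V] [Module ℝ V]
    [FiniteDimensional ℝ V] {P G : Set V} (hG : IsFacet P G) {φ : V →ₗ[ℝ] ℝ} {c : ℝ}
    (hφ : ∀ g ∈ G, φ g = c) (hP : ∃ p ∈ P, φ p ≠ c) : G = {p ∈ P | φ p = c} := by
  obtain ⟨⟨g, hg⟩, ⟨l, hl⟩, hdim⟩ := hG
  have hGP : G ⊆ P := fun y hy => by rw [hl] at hy; exact hy.1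
  have hle : vectorSpan ℝ G ≤ vectorSpan ℝ P ⊓ LinearMap.ker φ := by
    refine le_inf (vectorSpan_mono ℝ hGP) ?_
    rw [vectorSpan_def, Submodule.span_le]
    rintro _ ⟨y, hy, z, hz, rfl⟩
    simp [hφ y hy, hφ z hz]
  have hlt : vectorSpan ℝ P ⊓ LinearMap.ker φ < vectorSpan ℝ P := by
    refine lt_of_le_of_ne inf_le_left fun h => ?_
    obtain ⟨p, hp, hpc⟩ := hP
    have hmem : p - g ∈ vectorSpan ℝ P := vsub_mem_vectorSpan ℝ hp (hGP hg)
    rw [← h] at hmem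
    have := LinearMap.mem_ker.1 hmem.2
    rw [map_sub, hφ g hg, sub_eq_zero] at this
    exact hpc this
  have heq : vectorSpan ℝ G = vectorSpan ℝ P ⊓ LinearMap.ker φ := by
    refine Submodule.eq_of_le_of_finrank_le hle ?_
    have := Submodule.finrank_lt_finrank_of_lt hlt
    unfold affDim at hdim
    omega
  have hker : vectorSpan ℝ G ≤ LinearMap.ker l := by
    rw [vectorSpan_def, Submodule.span_le]
    rintro _ ⟨y, hy, z, hz, rfl⟩
    have hy' := hy
    have hz' := hz
    rw [hl] at hy' hz'
    simp [le_antisymm (hz'.2 y hy'.1) (hy'.2 z hz'.1)]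
  refine Set.Subset.antisymm (fun y hy => ⟨hGP hy, hφ y hy⟩) fun y hy => ?_
  have hmem : y - g ∈ vectorSpan ℝ G := by
    rw [heq]
    exact ⟨vsub_mem_vectorSpan ℝ hy.1 (hGP hg), by simp [hy.2, hφ g hg]⟩
  have hlyg : l y = l g := by
    have := LinearMap.mem_ker.1 (hker hmem)
    rwa [map_sub, sub_eq_zero] at this
  have hg' := hg
  rw [hl] at hg' ⊢
  exact ⟨hy.1, fun z hz => hlyg ▸ hg'.2 z hz⟩

/-- A linear equation satisfied by all maximizing generators of a convex hull holds at all its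
maximizing points. -/
theorem eq_of_mem_convexHull_of_maximizer {V : Type*} [AddCommGroup V] [Module ℝ V] {s : Set V}
    {l φ : V →ₗ[ℝ] ℝ} {m c : ℝ} (hm : ∀ y ∈ s, l y ≤ m) (hc : ∀ y ∈ s, l y = m → φ y = c)
    {y : V} (hy : y ∈ convexHull ℝ s) : l y ≤ m ∧ (l y = m → φ y = c) := by
  refine convexHull_min (t := {y | l y ≤ m ∧ (l y = m → φ y = c)})
    (fun y hy => ⟨hm y hy, hc y hy⟩) ?_ hy
  intro y hy z hz a b ha hb hab
  simp only [Set.mem_ofPred_eq, map_add, map_smul, smul_eq_mul] at hy hz ⊢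
  have e₁ := mul_le_mul_of_nonneg_left hy.1 ha
  have e₂ := mul_le_mul_of_nonneg_left hz.1 hb
  have e₃ : a * m + b * m = m := by rw [← add_mul, hab, one_mul]
  refine ⟨by linarith, fun h => ?_⟩
  have h₁ : a * φ y = a * c := by
    rcases ha.eq_or_lt with rfl | ha
    · simp
    · rw [hy.2 (mul_left_cancel₀ ha.ne' (le_antisymm e₁ (by linarith)))]
  have h₂ : b * φ z = b * c := by
    rcases hb.eq_or_lt with rfl | hb
    · simp
    · rw [hz.2 (mul_left_cancel₀ hb.ne' (le_antisymm e₂ (by linarith)))]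
  rw [h₁, h₂, ← add_mul, hab, one_mul]

open IsModularFamily in
theorem IsModularFamily.facets_convexHull {L E : Type*} [Lattice L] [Finite L] [Fintype E]
    [DecidableEq E] {x : L → Finset E} (hx : IsModularFamily x) :
    (facets (convexHull ℝ (Set.range fun a => indicatorVec (x a)))).Finite ∧
      (facets (convexHull ℝ (Set.range fun a => indicatorVec (x a)))).ncard
        ≤ 3 * Fintype.card E ^ 2 := by
  classical
  set P := convexHull ℝ (Set.range fun a => indicatorVec (x a)) with hPdef
  have hxP : ∀ a, indicatorVec (x a) ∈ P := fun a => subset_convexHull ℝ _ ⟨a, rfl⟩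
  let J := {j : L // SupIrred j}
  choose φ hφ using fun j : J => hx.exists_functional j.1 j.2
  let H : (J × J) ⊕ J ⊕ J → Set (E → ℝ) := Sum.elim
    (fun p => {y ∈ P | (φ p.1 - φ p.2) y = 0})
    (Sum.elim (fun j => {y ∈ P | φ j y = 0}) (fun j => {y ∈ P | φ j y = 1}))
  have hsub : facets P ⊆ Set.range H := by
    intro G hG
    obtain ⟨⟨g, hg⟩, ⟨l, hl⟩, hdim⟩ := id hG
    have hgP : g ∈ P := by rw [hl] at hg; exact hg.1
    obtain ⟨_, a₀, -⟩ := (convexHull_nonempty_iff (𝕜 := ℝ)).1 ⟨g, hgP⟩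
    have : Nonempty L := ⟨a₀⟩
    obtain ⟨m, hm⟩ := Finite.exists_max fun a => l (indicatorVec (x a))
    have hPm : ∀ y ∈ P, l y ≤ l (indicatorVec (x m)) := fun y hy =>
      (eq_of_mem_convexHull_of_maximizer (φ := 0) (c := 0)
        (Set.forall_mem_range.2 hm) (by simp) hy).1
    have hGm : ∀ y ∈ G, l y = l (indicatorVec (x m)) := fun y hy => by
      rw [hl] at hy
      exact le_antisymm (hPm y hy.1) (hy.2 _ (hxP m))
    have hyper : ∀ (ψ : (E → ℝ) →ₗ[ℝ] ℝ) (c : ℝ),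
        (∀ a, (∀ b, l (indicatorVec (x b)) ≤ l (indicatorVec (x a))) →
          ψ (indicatorVec (x a)) = c) →
        (∃ a, ψ (indicatorVec (x a)) ≠ c) → G = {y ∈ P | ψ y = c} := by
      rintro ψ c h ⟨a, ha⟩
      refine IsFacet.eq_inter_hyperplane hG (fun y hy => ?_) ⟨_, hxP a, ha⟩
      have hyP : y ∈ P := by rw [hl] at hy; exact hy.1
      refine (eq_of_mem_convexHull_of_maximizer (Set.forall_mem_range.2 hm) ?_ hyP).2 (hGm y hy)
      rintro _ ⟨a, rfl⟩ ha
      exact h a fun b => (hm b).trans ha.ge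
    by_contra hne
    have hconst := modular_eq_of_maximizers (l := fun a => l (indicatorVec (x a)))
      hx.le_or_le_of_le_sup (fun a b => by rw [← map_add, hx.indicatorVec_add, map_add]) ?_ ?_ ?_
    · have hGP : G = P := by
        rw [hl]
        refine Set.Subset.antisymm (fun y hy => hy.1) fun y hy => ⟨hy, fun z hz => ?_⟩
        -- With the zero functional every generator is a maximizer, so the equation passes from the
        -- generators to the whole hull.
        have h := (eq_of_mem_convexHull_of_maximizer (l := 0) (m := 0) (φ := l)
          (by simp) (c := l (indicatorVec (x m))) (s := Set.range fun a => indicatorVec (x a))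
          (by rintro _ ⟨a, rfl⟩ -; exact hconst a m) hy).2 rfl
        exact h ▸ hPm z hz
      rw [hGP] at hdim
      omega
    · intro j hj
      by_contra! h
      refine hne ⟨.inr (.inl ⟨j, hj⟩), (hyper (φ ⟨j, hj⟩) 0 (fun a ha => ?_) ⟨j, ?_⟩).symm⟩
      · rw [hφ, if_neg (h a ha)]
      · simp [hφ]
    · intro j hj
      by_contra! h
      obtain ⟨i, hi⟩ := not_isMin_iff.1 hj.1
      refine hne ⟨.inr (.inr ⟨j, hj⟩), (hyper (φ ⟨j, hj⟩) 1 (fun a ha => ?_) ⟨i, ?_⟩).symm⟩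
      · rw [hφ, if_pos (h a ha)]
      · simp [hφ, not_le_of_gt hi]
    · intro i j hi hj hij
      by_contra! h
      refine hne ⟨.inl (⟨i, hi⟩, ⟨j, hj⟩), (hyper (φ ⟨i, hi⟩ - φ ⟨j, hj⟩) 0 (fun a ha => ?_)
        ⟨i, ?_⟩).symm⟩
      · have : i ≤ a ↔ j ≤ a := ⟨h a ha, hij.le.trans⟩
        simp [hφ, this]
      · simp [hφ, not_le_of_gt hij]
  refine ⟨(Set.finite_range H).subset hsub, ?_⟩
  have h₁ : (facets P).ncard ≤ Nat.card ((J × J) ⊕ J ⊕ J) :=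
    (Set.ncard_le_ncard hsub (Set.finite_range H)).trans (Finite.card_range_le H)
  have h₂ : Nat.card J ≤ Fintype.card E := hx.card_supIrred_le
  rw [Nat.card_sum, Nat.card_sum, Nat.card_prod] at h₁
  -- The constant 3 comes from `|J|² + 2|J| ≤ 3|J|²`.
  nlinarith [Nat.le_self_pow two_ne_zero (Nat.card J)]

/-! ### Two choice functions on a common ground set -/

section TwoSided

variable {E : Type*} [DecidableEq E]

/-- A substitutable, consistent and cardinal monotone choice function. -/
structure IsCMChoice (A : Finset E) (C : Finset E → Finset E) : Prop where
  choice : IsChoice A C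
  subst : Substitutable A C
  cons : Consistent A C
  mono : CardinalMonotone A C

/-- Stability of a set with respect to two choice functions. -/
structure IsStableSet (A : Finset E) (C D : Finset E → Finset E) (a : Finset E) : Prop where
  subset : a ⊆ A
  fst_eq : C a = a
  snd_eq : D a = a
  not_block : ∀ e ∈ A, e ∈ C (a ∪ {e}) → e ∈ D (a ∪ {e}) → e ∈ a

theorem IsStableSet.swap {A : Finset E} {C D : Finset E → Finset E} {a : Finset E}
    (h : IsStableSet A C D a) : IsStableSet A D C a :=
  ⟨h.subset, h.snd_eq, h.fst_eq, fun e he h₁ h₂ => h.not_block e he h₂ h₁⟩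

variable {A : Finset E} {C D : Finset E → Finset E}

namespace IsCMChoice

/-- The choice from a superset of `a` all of whose elements are rejected next to `a`. -/
theorem eq_of_forall_mem (hC : IsCMChoice A C) {a Y : Finset E} (ha : C a = a) (haY : a ⊆ Y)
    (hY : Y ⊆ A) (h : ∀ e ∈ Y, e ∈ C (a ∪ {e}) → e ∈ a) : C Y = a := by
  have : C Y ⊆ a := fun e he => h e (hC.choice Y hY he) (hC.subst Y hY e he a haY)
  rw [hC.cons Y hY a this haY, ha]

theorem mem_of_mem (hC : IsCMChoice A C) {X Y : Finset E} {e : E} (hY : Y ⊆ A) (h : e ∈ C Y)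
    (hXY : X ⊆ Y) (he : e ∈ X) : e ∈ C X := by
  have := hC.subst Y hY e h X hXY
  rwa [Finset.union_eq_left.2 (Finset.singleton_subset_iff.2 he)] at this

/-- Consider the choice from `a ∪ b ∪ c`: by substitutability its elements from `a` lie in `b`, so
consistency reduces it first to `C (b ∪ c)`, then compares it with `C (a ∪ c)`. -/
theorem trans (hC : IsCMChoice A C) {a b c : Finset E} (ha : a ⊆ A) (hb : b ⊆ A) (hc : c ⊆ A)
    (hab : C (a ∪ b) = b) (hbc : C (b ∪ c) = c) : C (a ∪ c) = c := by
  have habc : a ∪ b ∪ c ⊆ A := Finset.union_subset (Finset.union_subset ha hb) hc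
  have h₁ : C (a ∪ b ∪ c) ⊆ b ∪ c := by
    intro e he
    rcases Finset.mem_union.1 (hC.choice _ habc he) with h | h
    · exact Finset.mem_union_left _
        (hab ▸ hC.mem_of_mem habc he Finset.subset_union_left h)
    · exact Finset.mem_union_right _ h
  have h₂ : C (a ∪ b ∪ c) = c := by
    rw [hC.cons _ habc _ h₁ (by rw [Finset.union_assoc]; exact Finset.subset_union_right), hbc]
  have := hC.cons _ habc (a ∪ c) (by rw [h₂]; exact Finset.subset_union_right)
    (Finset.union_subset_union_left Finset.subset_union_left)
  rw [← this, h₂]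

end IsCMChoice

namespace IsStableSet

/-- The two sides rank stable sets oppositely. -/
theorem opposed (hC : IsCMChoice A C) (hD : IsCMChoice A D) {a b : Finset E}
    (ha : IsStableSet A C D a) (hb : IsStableSet A C D b) (h : C (a ∪ b) = b) :
    D (b ∪ a) = a := by
  refine hD.eq_of_forall_mem ha.snd_eq Finset.subset_union_right
    (Finset.union_subset hb.subset ha.subset) fun e he heD => ?_
  rcases Finset.mem_union.1 he with he | he
  · refine ha.not_block e (hb.subset he) ?_ heD
    exact hC.subst _ (Finset.union_subset ha.subset hb.subset) e (h.symm ▸ he) a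
      Finset.subset_union_left
  · exact he

theorem mem_of_between (hC : IsCMChoice A C) (hD : IsCMChoice A D) {a b c : Finset E}
    (ha : IsStableSet A C D a) (hb : IsStableSet A C D b) (hc : IsStableSet A C D c)
    (hab : C (a ∪ b) = b) (hbc : C (b ∪ c) = c) {e : E} (hea : e ∈ a) (hec : e ∈ c) : e ∈ b := by
  refine hb.not_block e (ha.subset hea) ?_ ?_
  · exact hC.subst _ (Finset.union_subset hb.subset hc.subset) e (hbc.symm ▸ hec) b
      Finset.subset_union_left
  · have hba := ha.opposed hC hD hb hab
    exact hD.subst _ (Finset.union_subset hb.subset ha.subset) e (hba.symm ▸ hea) b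
      Finset.subset_union_left

/-- Enlarge `a` to the set `P a` of elements that `C` does not want to add to it, and let `c = C (P
a ∪ P b)`. The second side chooses from `Y`, everything except what `C` rejects here.
Substitutability gives `c ⊆ D Y`, and cardinal monotonicity on both sides gives `|a| ≤ |c| ≤ |D Y| ≤
|a|`, so `D Y = c`. Every element outside `c` is then refused by one side. -/
theorem exists_join (hC : IsCMChoice A C) (hD : IsCMChoice A D) {a b : Finset E}
    (ha : IsStableSet A C D a) (hb : IsStableSet A C D b) :
    ∃ c, IsStableSet A C D c ∧ C (a ∪ c) = c ∧ C (b ∪ c) = c ∧ c ⊆ a ∪ b ∧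
      c.card = a.card ∧ c.card = b.card := by
  let P : Finset E → Finset E := fun a => A.filter fun e => e ∈ C (a ∪ {e}) → e ∈ a
  have hPA : ∀ a, P a ⊆ A := fun a => Finset.filter_subset _ _
  have haP : ∀ {a}, IsStableSet A C D a → a ⊆ P a := fun ha e he =>
    Finset.mem_filter.2 ⟨ha.subset he, fun _ => he⟩
  have hCP : ∀ {a}, IsStableSet A C D a → C (P a) = a := fun ha =>
    hC.eq_of_forall_mem ha.fst_eq (haP ha) (hPA _) fun e he => (Finset.mem_filter.1 he).2
  have hDP : ∀ {a}, IsStableSet A C D a → D (A \ (P a \ a)) = a := fun {a} ha => by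
    refine hD.eq_of_forall_mem ha.snd_eq (fun e he => ?_) Finset.sdiff_subset fun e he heD => ?_
    · simp [ha.subset he, he]
    · by_contra hea
      simp only [Finset.mem_sdiff, not_and, not_not] at he
      exact hea (he.2 (Finset.mem_filter.2 ⟨he.1, fun heC => ha.not_block e he.1 heC heD⟩))
  set X := P a ∪ P b with hX
  have hXA : X ⊆ A := Finset.union_subset (hPA a) (hPA b)
  set c := C X with hc
  have hcX : c ⊆ X := hC.choice X hXA
  have mem_a : ∀ e ∈ c, e ∈ P a → e ∈ a := fun e he hea =>
    hCP ha ▸ hC.mem_of_mem hXA he Finset.subset_union_left hea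
  have mem_b : ∀ e ∈ c, e ∈ P b → e ∈ b := fun e he heb =>
    hCP hb ▸ hC.mem_of_mem hXA he Finset.subset_union_right heb
  set Y := A \ (X \ c) with hY
  have hYA : Y ⊆ A := Finset.sdiff_subset
  have hcY : c ⊆ Y := fun e he => by simp [hY, hXA (hcX he), he]
  have hYa : Y ⊆ A \ (P a \ a) := by
    intro e he
    simp only [hY, Finset.mem_sdiff, not_and, not_not] at he ⊢
    exact ⟨he.1, fun hea => mem_a e (he.2 (Finset.mem_union_left _ hea)) hea⟩
  have hYb : Y ⊆ A \ (P b \ b) := by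
    intro e he
    simp only [hY, Finset.mem_sdiff, not_and, not_not] at he ⊢
    exact ⟨he.1, fun heb => mem_b e (he.2 (Finset.mem_union_right _ heb)) heb⟩
  have hcab : c ⊆ a ∪ b := by
    intro e he
    rcases Finset.mem_union.1 (hcX he) with h | h
    · exact Finset.mem_union_left _ (mem_a e he h)
    · exact Finset.mem_union_right _ (mem_b e he h)
  have hcD : c ⊆ D Y := by
    intro e he
    rcases Finset.mem_union.1 (hcab he) with h | h
    · exact hD.mem_of_mem Finset.sdiff_subset ((hDP ha).symm ▸ h) hYa (hcY he)
    · exact hD.mem_of_mem Finset.sdiff_subset ((hDP hb).symm ▸ h) hYb (hcY he)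
  have a_le : a.card ≤ c.card := by
    have := hC.mono X hXA (P a) Finset.subset_union_left
    rwa [hCP ha] at this
  have b_le : b.card ≤ c.card := by
    have := hC.mono X hXA (P b) Finset.subset_union_right
    rwa [hCP hb] at this
  have le_a : (D Y).card ≤ a.card := by
    have := hD.mono _ Finset.sdiff_subset Y hYa
    rwa [hDP ha] at this
  have le_b : (D Y).card ≤ b.card := by
    have := hD.mono _ Finset.sdiff_subset Y hYb
    rwa [hDP hb] at this
  have hDY : D Y = c := (Finset.eq_of_subset_of_card_le hcD (le_a.trans a_le)).symm
  have between_C : ∀ T, c ⊆ T → T ⊆ X → C T = c := fun T h₁ h₂ => (hC.cons X hXA T h₁ h₂).symm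
  have between_D : ∀ T, c ⊆ T → T ⊆ Y → D T = c := fun T h₁ h₂ => by
    rw [← hDY]; exact (hD.cons Y hYA T (hDY ▸ h₁) h₂).symm
  refine ⟨c, ⟨hcX.trans hXA, between_C c subset_rfl hcX, between_D c subset_rfl hcY, ?_⟩,
    between_C _ Finset.subset_union_right
      (Finset.union_subset ((haP ha).trans Finset.subset_union_left) hcX),
    between_C _ Finset.subset_union_right
      (Finset.union_subset ((haP hb).trans Finset.subset_union_right) hcX), hcab,
    le_antisymm ((Finset.card_le_card hcD).trans le_a) a_le,
    le_antisymm ((Finset.card_le_card hcD).trans le_b) b_le⟩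
  intro e he heC heD
  by_cases heX : e ∈ X
  · rwa [between_C _ Finset.subset_union_left
      (Finset.union_subset hcX (Finset.singleton_subset_iff.2 heX))] at heC
  · have heY : e ∈ Y := by simp [hY, he, heX]
    rwa [between_D _ Finset.subset_union_left
      (Finset.union_subset hcY (Finset.singleton_subset_iff.2 heY))] at heD

/-- Only `c ⊆ a ∪ b` matters: no element of `a` or `b` outside `u` is chosen next to `u`. -/
theorem join_le (hC : IsCMChoice A C) {a b c u : Finset E}
    (ha : IsStableSet A C D a) (hb : IsStableSet A C D b) (hu : IsStableSet A C D u)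
    (hc : c ⊆ a ∪ b) (hau : C (a ∪ u) = u) (hbu : C (b ∪ u) = u) : C (c ∪ u) = u := by
  have hcA : c ⊆ A := hc.trans (Finset.union_subset ha.subset hb.subset)
  refine hC.eq_of_forall_mem hu.fst_eq Finset.subset_union_right
    (Finset.union_subset hcA hu.subset) fun e he heC => ?_
  have key : ∀ {a}, IsStableSet A C D a → C (a ∪ u) = u → e ∈ a → e ∈ u := by
    intro a ha hau hea
    have hsub : u ∪ {e} ⊆ a ∪ u := Finset.union_subset Finset.subset_union_right
      (Finset.singleton_subset_iff.2 (Finset.mem_union_left _ hea))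
    have := hC.cons _ (Finset.union_subset ha.subset hu.subset) (u ∪ {e})
      (by rw [hau]; exact Finset.subset_union_left) hsub
    rwa [← this, hau] at heC
  rcases Finset.mem_union.1 he with he | he
  · rcases Finset.mem_union.1 (hc he) with h | h
    · exact key ha hau h
    · exact key hb hbu h
  · exact he

end IsStableSet

/-- The type of stable sets. -/
def StableSet (A : Finset E) (C D : Finset E → Finset E) : Type _ :=
  {a : Finset E // IsStableSet A C D a}

instance [Finite E] : Finite (StableSet A C D) :=
  inferInstanceAs (Finite {a : Finset E // IsStableSet A C D a})

/-- The lattice of stable sets, ordered by the preference of the first side. -/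
noncomputable abbrev stableLattice (hC : IsCMChoice A C) (hD : IsCMChoice A D) :
    Lattice (StableSet A C D) where
  le a b := C (a.1 ∪ b.1) = b.1
  le_refl a := by rw [Finset.union_self, a.2.fst_eq]
  le_trans a b c := hC.trans a.2.subset b.2.subset c.2.subset
  le_antisymm a b hab hba := by
    rw [Finset.union_comm] at hba
    exact Subtype.ext (hba.symm.trans hab)
  sup a b := ⟨_, (a.2.exists_join hC hD b.2).choose_spec.1⟩
  le_sup_left a b := (a.2.exists_join hC hD b.2).choose_spec.2.1
  le_sup_right a b := (a.2.exists_join hC hD b.2).choose_spec.2.2.1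
  sup_le a b u hau hbu := IsStableSet.join_le hC a.2 b.2 u.2
    (a.2.exists_join hC hD b.2).choose_spec.2.2.2.1 hau hbu
  -- The two sides have opposite orders on stable sets, so the meet is the join formed for the
  -- second side.
  inf a b := ⟨_, (a.2.swap.exists_join hD hC b.2.swap).choose_spec.1.swap⟩
  inf_le_left a b :=
    a.2.swap.opposed hD hC (a.2.swap.exists_join hD hC b.2.swap).choose_spec.1
      (a.2.swap.exists_join hD hC b.2.swap).choose_spec.2.1
  inf_le_right a b :=
    b.2.swap.opposed hD hC (a.2.swap.exists_join hD hC b.2.swap).choose_spec.1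
      (a.2.swap.exists_join hD hC b.2.swap).choose_spec.2.2.1
  le_inf u a b hua hub := by
    have h := (a.2.swap.exists_join hD hC b.2.swap).choose_spec
    exact h.1.opposed hD hC u.2.swap (IsStableSet.join_le hD a.2.swap b.2.swap u.2.swap h.2.2.2.1
      (u.2.opposed hC hD a.2 hua) (u.2.opposed hC hD b.2 hub))

/-- Union and intersection of join and meet are contained in those of `a` and `b`, the latter by
convexity. All four sets have equal size, so the cardinalities sum to the same total and both
inclusions are equalities. -/
theorem isModularFamily_stable (hC : IsCMChoice A C) (hD : IsCMChoice A D) :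
    letI := stableLattice hC hD
    IsModularFamily (fun a : StableSet A C D => a.1) := by
  let := stableLattice hC hD
  have convex : ∀ (a b c : StableSet A C D) (e : E), a ≤ b → b ≤ c →
      e ∈ a.1 → e ∈ c.1 → e ∈ b.1 := fun a b c e hab hbc =>
    IsStableSet.mem_of_between hC hD a.2 b.2 c.2 hab hbc
  have key : ∀ a b : StableSet A C D, (a ⊔ b).1 ∪ (a ⊓ b).1 = a.1 ∪ b.1 ∧
      (a ⊔ b).1 ∩ (a ⊓ b).1 = a.1 ∩ b.1 := by
    intro a b
    obtain ⟨-, -, -, hsup, hsupa, hsupb⟩ := (a.2.exists_join hC hD b.2).choose_spec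
    obtain ⟨-, -, -, hinf, hinfa, hinfb⟩ := (a.2.swap.exists_join hD hC b.2.swap).choose_spec
    change (a ⊔ b).1 ⊆ _ at hsup
    change (a ⊔ b).1.card = _ at hsupa
    change (a ⊓ b).1 ⊆ _ at hinf
    change (a ⊓ b).1.card = _ at hinfb
    have hu : (a ⊔ b).1 ∪ (a ⊓ b).1 ⊆ a.1 ∪ b.1 := Finset.union_subset hsup hinf
    have hi : (a ⊔ b).1 ∩ (a ⊓ b).1 ⊆ a.1 ∩ b.1 := fun e he => by
      rw [Finset.mem_inter] at he ⊢
      exact ⟨convex _ _ _ e inf_le_left le_sup_left he.2 he.1,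
        convex _ _ _ e inf_le_right le_sup_right he.2 he.1⟩
    have h₁ := Finset.card_union_add_card_inter (a ⊔ b).1 (a ⊓ b).1
    have h₂ := Finset.card_union_add_card_inter a.1 b.1
    have h₃ := Finset.card_le_card hu
    have h₄ := Finset.card_le_card hi
    exact ⟨Finset.eq_of_subset_of_card_le hu (by omega),
      Finset.eq_of_subset_of_card_le hi (by omega)⟩
  refine ⟨fun a b => (key a b).1, fun a b => (key a b).2, convex, fun a b _ hba => ?_⟩
  obtain ⟨-, -, -, -, ha, hb⟩ := (a.2.exists_join hC hD b.2).choose_spec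
  exact Subtype.ext (Finset.eq_of_subset_of_card_le hba (ha.symm.trans hb).le).symm

end TwoSided

/-! ### Matching markets as pairs of choice functions -/

section Market

variable {F W : Type*} [Fintype F] [Fintype W] [DecidableEq F] [DecidableEq W]

/-- The joint choice of all firms from a set of pairs. -/
def firmsChoice (c : F → Finset W → Finset W) (X : Finset (F × W)) : Finset (F × W) :=
  Finset.univ.filter fun p => p.2 ∈ c p.1 (workersOf X p.1)

/-- The joint choice of all workers from a set of pairs. -/
def workersChoice (c : W → Finset F → Finset F) (X : Finset (F × W)) : Finset (F × W) :=
  Finset.univ.filter fun p => p.1 ∈ c p.2 (firmsOf X p.2)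

omit [Fintype F] in
@[simp] theorem mem_workersOf {X : Finset (F × W)} {f : F} {w : W} :
    w ∈ workersOf X f ↔ (f, w) ∈ X := by simp [workersOf]

omit [Fintype W] in
@[simp] theorem mem_firmsOf {X : Finset (F × W)} {f : F} {w : W} :
    f ∈ firmsOf X w ↔ (f, w) ∈ X := by simp [firmsOf]

@[simp] theorem mem_firmsChoice {c : F → Finset W → Finset W} {X : Finset (F × W)} {p : F × W} :
    p ∈ firmsChoice c X ↔ p.2 ∈ c p.1 (workersOf X p.1) := by simp [firmsChoice]

@[simp] theorem mem_workersChoice {c : W → Finset F → Finset F} {X : Finset (F × W)} {p : F × W} :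
    p ∈ workersChoice c X ↔ p.1 ∈ c p.2 (firmsOf X p.2) := by simp [workersChoice]

omit [Fintype F] in
theorem workersOf_mono {X Y : Finset (F × W)} (h : X ⊆ Y) (f : F) :
    workersOf X f ⊆ workersOf Y f := fun w hw => by
  rw [mem_workersOf] at hw ⊢; exact h hw

omit [Fintype W] in
theorem firmsOf_mono {X Y : Finset (F × W)} (h : X ⊆ Y) (w : W) :
    firmsOf X w ⊆ firmsOf Y w := fun f hf => by
  rw [mem_firmsOf] at hf ⊢; exact h hf

omit [Fintype F] in
theorem workersOf_union_singleton (X : Finset (F × W)) (f : F) (w : W) :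
    workersOf (X ∪ {(f, w)}) f = workersOf X f ∪ {w} := by
  ext; simp

omit [Fintype W] in
theorem firmsOf_union_singleton (X : Finset (F × W)) (f : F) (w : W) :
    firmsOf (X ∪ {(f, w)}) w = firmsOf X w ∪ {f} := by
  ext; simp

theorem workersOf_firmsChoice (c : F → Finset W → Finset W) (X : Finset (F × W)) (f : F) :
    workersOf (firmsChoice c X) f = c f (workersOf X f) := by
  ext; simp

theorem firmsOf_workersChoice (c : W → Finset F → Finset F) (X : Finset (F × W)) (w : W) :
    firmsOf (workersChoice c X) w = c w (firmsOf X w) := by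
  ext; simp

omit [Fintype F] in
theorem eq_iff_workersOf {X Y : Finset (F × W)} :
    X = Y ↔ ∀ f, workersOf X f = workersOf Y f := by
  refine ⟨fun h f => by rw [h], fun h => ?_⟩
  ext ⟨f, w⟩
  rw [← mem_workersOf, h f, mem_workersOf]

omit [Fintype W] in
theorem eq_iff_firmsOf {X Y : Finset (F × W)} :
    X = Y ↔ ∀ w, firmsOf X w = firmsOf Y w := by
  refine ⟨fun h f => by rw [h], fun h => ?_⟩
  ext ⟨f, w⟩
  rw [← mem_firmsOf, h w, mem_firmsOf]

theorem card_eq_sum_workersOf (X : Finset (F × W)) : X.card = ∑ f, (workersOf X f).card := by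
  rw [Finset.card_eq_sum_card_fiberwise (f := Prod.fst) (t := Finset.univ) (by simp)]
  refine Finset.sum_congr rfl fun f _ => ?_
  refine Finset.card_bij' (fun p _ => p.2) (fun w _ => (f, w)) ?_ ?_ ?_ ?_
  · rintro ⟨g, w⟩ h
    obtain ⟨h, rfl⟩ := Finset.mem_filter.1 h
    simpa using h
  · intro w h
    simpa using h
  · rintro ⟨g, w⟩ h
    obtain ⟨h, rfl⟩ := Finset.mem_filter.1 h
    rfl
  · intro w h
    rfl

theorem card_eq_sum_firmsOf (X : Finset (F × W)) : X.card = ∑ w, (firmsOf X w).card := by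
  rw [Finset.card_eq_sum_card_fiberwise (f := Prod.snd) (t := Finset.univ) (by simp)]
  refine Finset.sum_congr rfl fun w _ => ?_
  refine Finset.card_bij' (fun p _ => p.1) (fun f _ => (f, w)) ?_ ?_ ?_ ?_
  · rintro ⟨f, v⟩ h
    obtain ⟨h, rfl⟩ := Finset.mem_filter.1 h
    simpa using h
  · intro f h
    simpa using h
  · rintro ⟨f, v⟩ h
    obtain ⟨h, rfl⟩ := Finset.mem_filter.1 h
    rfl
  · intro f h
    rfl

namespace MatchingMarket

variable {M : MatchingMarket F W}

theorem IsCMModel.isCMChoice_firms (hM : M.IsCMModel) :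
    IsCMChoice M.acceptable (firmsChoice M.choiceF) where
  choice := fun S hS ⟨f, w⟩ h =>
    mem_workersOf.1 (M.isChoice_choiceF f _ (workersOf_mono hS f) (mem_firmsChoice.1 h))
  subst := fun S hS ⟨f, w⟩ h T hT => by
    rw [mem_firmsChoice] at h ⊢
    rw [workersOf_union_singleton]
    exact (hM.1 f).1 (workersOf S f) (workersOf_mono hS f) w h (workersOf T f) (workersOf_mono hT f)
  cons := fun S hS T h₁ h₂ => by
    rw [eq_iff_workersOf]
    intro f
    rw [workersOf_firmsChoice, workersOf_firmsChoice]
    refine (hM.1 f).2.1 _ (workersOf_mono hS f) _ ?_ (workersOf_mono h₂ f)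
    rw [← workersOf_firmsChoice M.choiceF S f]
    exact workersOf_mono h₁ f
  mono := fun T hT S hS => by
    rw [card_eq_sum_workersOf, card_eq_sum_workersOf]
    refine Finset.sum_le_sum fun f _ => ?_
    rw [workersOf_firmsChoice, workersOf_firmsChoice]
    exact (hM.1 f).2.2 _ (workersOf_mono hT f) _ (workersOf_mono hS f)

theorem IsCMModel.isCMChoice_workers (hM : M.IsCMModel) :
    IsCMChoice M.acceptable (workersChoice M.choiceW) where
  choice := fun S hS ⟨f, w⟩ h =>
    mem_firmsOf.1 (M.isChoice_choiceW w _ (firmsOf_mono hS w) (mem_workersChoice.1 h))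
  subst := fun S hS ⟨f, w⟩ h T hT => by
    rw [mem_workersChoice] at h ⊢
    rw [firmsOf_union_singleton]
    exact (hM.2 w).1 (firmsOf S w) (firmsOf_mono hS w) f h (firmsOf T w) (firmsOf_mono hT w)
  cons := fun S hS T h₁ h₂ => by
    rw [eq_iff_firmsOf]
    intro w
    rw [firmsOf_workersChoice, firmsOf_workersChoice]
    refine (hM.2 w).2.1 _ (firmsOf_mono hS w) _ ?_ (firmsOf_mono h₂ w)
    rw [← firmsOf_workersChoice M.choiceW S w]
    exact firmsOf_mono h₁ w
  mono := fun T hT S hS => by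
    rw [card_eq_sum_firmsOf, card_eq_sum_firmsOf]
    refine Finset.sum_le_sum fun w _ => ?_
    rw [firmsOf_workersChoice, firmsOf_workersChoice]
    exact (hM.2 w).2.2 _ (firmsOf_mono hT w) _ (firmsOf_mono hS w)

/-- Whether `(f, w)` is jointly chosen depends only on the partners of `f` (or of `w`), so blocking
can be tested at that firm and that worker. -/
theorem isStable_iff_isStableSet {μ : Finset (F × W)} : M.IsStable μ ↔
    IsStableSet M.acceptable (firmsChoice M.choiceF) (workersChoice M.choiceW) μ := by
  have hF : firmsChoice M.choiceF μ = μ ↔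
      ∀ f, M.choiceF f (workersOf μ f) = workersOf μ f := by
    simp only [eq_iff_workersOf, workersOf_firmsChoice]
  have hW : workersChoice M.choiceW μ = μ ↔
      ∀ w, M.choiceW w (firmsOf μ w) = firmsOf μ w := by
    simp only [eq_iff_firmsOf, firmsOf_workersChoice]
  constructor
  · rintro ⟨hμ, ⟨h₁, h₂⟩, hb⟩
    refine ⟨hμ, hF.2 h₁, hW.2 h₂, ?_⟩
    rintro ⟨f, w⟩ hacc hf hw
    rw [mem_firmsChoice, workersOf_union_singleton] at hf
    rw [mem_workersChoice, firmsOf_union_singleton] at hw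
    by_contra hn
    exact hb f w ⟨hacc, hn, hf, hw⟩
  · rintro ⟨hμ, h₁, h₂, hb⟩
    refine ⟨hμ, ⟨hF.1 h₁, hW.1 h₂⟩, ?_⟩
    rintro f w ⟨hacc, hn, hf, hw⟩
    refine hn (hb (f, w) hacc ?_ ?_)
    · rwa [mem_firmsChoice, workersOf_union_singleton]
    · rwa [mem_workersChoice, firmsOf_union_singleton]

end MatchingMarket

end Market

end StableMatching

theorem mainTheorem5 :
    ∃ C : ℕ, ∀ (F W : Type*) [Fintype F] [Fintype W] [DecidableEq F] [DecidableEq W]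
      (M : StableMatching.MatchingMarket F W), M.IsCMModel →
        (StableMatching.facets M.stablePolytope).Finite ∧
          (StableMatching.facets M.stablePolytope).ncard
            ≤ C * (Fintype.card F ^ 2 * Fintype.card W ^ 2) := by
  refine ⟨3, fun F W _ _ _ _ M hM => ?_⟩
  let := StableMatching.stableLattice hM.isCMChoice_firms hM.isCMChoice_workers
  have h := (StableMatching.isModularFamily_stable hM.isCMChoice_firms
    hM.isCMChoice_workers).facets_convexHull
  have hP : M.stablePolytope = convexHull ℝ (Set.range
      fun a : StableMatching.StableSet M.acceptable
        (StableMatching.firmsChoice M.choiceF) (StableMatching.workersChoice M.choiceW) =>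
      StableMatching.IsModularFamily.indicatorVec a.1) := by
    unfold StableMatching.MatchingMarket.stablePolytope
    congr 1
    ext y
    constructor
    · rintro ⟨μ, hμ, rfl⟩
      exact ⟨⟨μ, StableMatching.MatchingMarket.isStable_iff_isStableSet.1 hμ⟩, rfl⟩
    · rintro ⟨μ, rfl⟩
      exact ⟨μ.1, StableMatching.MatchingMarket.isStable_iff_isStableSet.2 μ.2, rfl⟩
  rwa [hP, ← mul_pow, ← Fintype.card_prod]
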